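/- Conventions. Write $x^g=g^{-1}xg$. For a group $H$, a subset $X\subseteq H$ and $n\in\mathbb N$, let $$C_n(X,H)=\{x_1^{g_1}x_2^{g_2}\cdots x_n^{g_n} : g_i\in H,\ x_i\in X\text{ or }x_i^{-1}\in X\}.$$ A set $Y\subseteq H$ is $n$-separated from $X$ if $Y\cap C_n(X,H)=\emptyset$. For a class $\mathcal K$ of groups, a group $G$ is $\mathcal K$-approximable if for every finite $\Phi\subseteq G$ and every $n\in\mathbb N$ there are $H\in\mathcal K$ and a map $\varphi:G\to H$ with $\varphi(1)=1$ such that $\varphi(\Phi\setminus\{1\})$ is $n$-separated from $\{\varphi(g)\varphi(h)\varphi(gh)^{-1} : g,h,gh\in\Phi\}$. Let $Nil$, $Sol$, $Alt$, $Sym$, $Fin$ be the classes of finite nilpotent, finite solvable, finite alternating, finite symmetric and all finite groups, respectively. For $m\ge 1$ let $\|\sigma\|=|\{x:\sigma(x)\ne x\}|/m$ be the normalized Hamming length on the symmetric group $S_m$. A group $G$ is sofic if there is $\alpha:G\to\mathbb R$ with $\alpha(1)=0$ and $\alpha(g)>0$ for $g\neq1$ such that for every finite $\Phi\subseteq G$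 and every $\varepsilon>0$ there are $m\ge1$ and a map $\varphi:G\to S_m$ with $\varphi(1)=1$, with $\|\varphi(g)\|\ge\alpha(g)$ for all $g\in\Phi$, and with $\|\varphi(gh)(\varphi(g)\varphi(h))^{-1}\|<\varepsilon$ whenever $g,h,gh\in\Phi$. A group $G$ is existentially closed if every finite system of equations $w=1$ and inequations $w\neq1$, in finitely many variables and with coefficients in $G$, that has a solution in some group containing $G$ already has a solution in $G$. Proposition. Let $G$ be an existentially closed group. 1. For each $\mathcal K\in\{Nil, Sol, Alt, Sym, Fin\}$, the group $G$ is $\mathcal K$-approximable if and only if all groups are $\mathcal K$-approximable. 2. In particular, $G$ is sofic if and only if all groups are sofic. -/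

import Mathlib

universe u v

namespace GroupApprox

/-- The set `C_n(X, H)` of `n`-consequences of `X` in `H`: all products
`x₁^{g₁} ⋯ xₙ^{gₙ}` with `xᵢ ∈ X` or `xᵢ⁻¹ ∈ X` and `gᵢ ∈ H`, where `x^g = g⁻¹ x g`. -/
def consequences {H : Type*} [Group H] (n : ℕ) (X : Set H) : Set H :=
  {y | ∃ x g : Fin n → H, (∀ i, x i ∈ X ∨ (x i)⁻¹ ∈ X) ∧
    y = (List.ofFn fun i => (g i)⁻¹ * x i * g i).prod}

/-- `Y` is `n`-separated from `X` in `H`. -/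
def IsSeparated {H : Type*} [Group H] (n : ℕ) (Y X : Set H) : Prop :=
  Y ∩ consequences n X = ∅

/-- A class of groups. All classes below consist of finite groups, so nothing is lost by
taking their members in the lowest universe. -/
abbrev GroupClass : Type 1 := ∀ (H : Type) [Group H], Prop

/-- The class of finite nilpotent groups. -/
def NilClass : GroupClass := fun H _ => Finite H ∧ Group.IsNilpotent H

/-- The class of finite solvable groups. -/
def SolClass : GroupClass := fun H _ => Finite H ∧ Group.IsSolvable H

/-- The class of finite alternating groups. -/
def AltClass : GroupClass := fun H _ =>
  ∃ m : ℕ, 0 < m ∧ Nonempty (H ≃* alternatingGroup (Fin m))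

/-- The class of finite symmetric groups. -/
def SymClass : GroupClass := fun H _ =>
  ∃ m : ℕ, 0 < m ∧ Nonempty (H ≃* Equiv.Perm (Fin m))

/-- The class of all finite groups. -/
def FinClass : GroupClass := fun H _ => Finite H

/-- `G` is `K`-approximable. The map `φ` is given on all of `G`, but apart from `φ 1 = 1`
only its values on the finite set `Φ` are constrained. -/
def IsApproximable (K : GroupClass) (G : Type u) [Group G] : Prop :=
  ∀ (Φ : Finset G) (n : ℕ), ∃ (H : Type) (_ : Group H), K H ∧ ∃ φ : G → H,
    φ 1 = 1 ∧
    IsSeparated n (φ '' ((Φ : Set G) \ {1}))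
      {z | ∃ g ∈ Φ, ∃ h ∈ Φ, g * h ∈ Φ ∧ z = φ g * φ h * (φ (g * h))⁻¹}

/-- The normalized Hamming length on the symmetric group of `m` points. -/
noncomputable def hammingLength {m : ℕ} (σ : Equiv.Perm (Fin m)) : ℝ :=
  (Nat.card {x : Fin m // σ x ≠ x} : ℝ) / (m : ℝ)

/-- `G` is sofic: metrically approximable by finite symmetric groups with normalized
Hamming lengths. -/
def IsSofic (G : Type u) [Group G] : Prop :=
  ∃ α : G → ℝ, α 1 = 0 ∧ (∀ g, g ≠ 1 → 0 < α g) ∧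
    ∀ (Φ : Finset G) (ε : ℝ), 0 < ε →
      ∃ m : ℕ, 0 < m ∧ ∃ φ : G → Equiv.Perm (Fin m),
        φ 1 = 1 ∧
        (∀ g ∈ Φ, α g ≤ hammingLength (φ g)) ∧
        ∀ g ∈ Φ, ∀ h ∈ Φ, g * h ∈ Φ → hammingLength (φ (g * h) * (φ g * φ h)⁻¹) < ε

/-- A word with coefficients in `G` in the variables `x₁, …, x_k`: an element of the free
product of `G` and the free group on `x₁, …, x_k`. -/
abbrev Word (G : Type u) [Group G] (k : ℕ) : Type u :=
  Monoid.Coprod G (FreeGroup (Fin k))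

/-- The value of a word at a tuple `x` in `H`, its coefficients being sent to `H` by `f`. -/
def Word.value {G : Type u} [Group G] {H : Type u} [Group H] {k : ℕ}
    (f : G →* H) (x : Fin k → H) (w : Word G k) : H :=
  Monoid.Coprod.lift f (FreeGroup.lift x) w

/-- The tuple `x` in `H` satisfies the equations `w = 1` for `w ∈ E` and the inequations
`w ≠ 1` for `w ∈ N`. -/
def IsSolution {G : Type u} [Group G] {H : Type u} [Group H] {k : ℕ}
    (f : G →* H) (E N : Finset (Word G k)) (x : Fin k → H) : Prop :=
  (∀ w ∈ E, Word.value f x w = 1) ∧ ∀ w ∈ N, Word.value f x w ≠ 1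

/-- `G` is existentially closed: every finite system of equations and inequations with
coefficients in `G` that has a solution in some group containing `G` has a solution in `G`.
(The subgroup generated by `G` and a solution is no larger than `max |G| ℵ₀`, so
overgroups in the universe of `G` suffice.) -/
def IsExistentiallyClosed (G : Type u) [Group G] : Prop :=
  ∀ (k : ℕ) (E N : Finset (Word G k)),
    (∃ (H : Type u) (_ : Group H) (f : G →* H), Function.Injective f ∧
      ∃ x : Fin k → H, IsSolution f E N x) →
    ∃ x : Fin k → G, IsSolution (MonoidHom.id G) E N x

end GroupApprox

namespace GroupApprox

open Filter Topology

/-! Approximability and soficity only test finite pieces of a multiplication table, so both pass to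
a group whose finite subsets embed locally into groups having the property. The table of a finite
subset of any group is a finite system of equations and inequations. It is solvable in a direct
product with `G`, hence in `G` itself, so every group embeds locally into `G`. The converse needs an
argument because the universes may differ: a finite subset generates a countable group, which has a
copy in every universe. -/

/-- `ψ` is multiplicative on `Φ` where this makes sense, and is nontrivial on the nontrivial
elements of `Φ`. -/
structure IsLocalEmbedding {A : Type*} {B : Type*} [Group A] [Group B] (Φ : Finset A)
    (ψ : A → B) : Prop where
  map_one : ψ 1 = 1
  map_ne_one : ∀ g ∈ Φ, g ≠ 1 → ψ g ≠ 1
  map_mul : ∀ g ∈ Φ, ∀ h ∈ Φ, g * h ∈ Φ → ψ (g * h) = ψ g * ψ h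

theorem consequences_mono {H : Type*} [Group H] (n : ℕ) {X X' : Set H} (h : X ⊆ X') :
    consequences n X ⊆ consequences n X' := by
  rintro y ⟨x, g, hx, rfl⟩
  exact ⟨x, g, fun i => (hx i).imp (@h _) (@h _), rfl⟩

theorem IsSeparated.mono {H : Type*} [Group H] {n : ℕ} {X X' Y Y' : Set H}
    (h : IsSeparated n Y' X') (hY : Y ⊆ Y') (hX : X ⊆ X') : IsSeparated n Y X :=
  Set.subset_empty_iff.mp <|
    (Set.inter_subset_inter hY (consequences_mono n hX)).trans (Set.subset_empty_iff.mpr h)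

theorem isApproximable_of_localEmbeddings {K : GroupClass} {A : Type u} [Group A]
    (h : ∀ Φ : Finset A, ∃ (B : Type v) (_ : Group B), IsApproximable K B ∧
      ∃ ψ : A → B, IsLocalEmbedding Φ ψ) : IsApproximable K A := by
  classical
  intro Φ n
  obtain ⟨B, _, hB, ψ, hψ⟩ := h Φ
  obtain ⟨H, _, hH, φ, hφ, hsep⟩ := hB (Φ.image ψ) n
  refine ⟨H, _, hH, φ ∘ ψ, by simp [hψ.map_one, hφ], hsep.mono ?_ ?_⟩
  · rintro _ ⟨g, ⟨hg, hg1⟩, rfl⟩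
    exact ⟨ψ g, ⟨by simpa using ⟨g, hg, rfl⟩, hψ.map_ne_one g hg hg1⟩, rfl⟩
  · rintro _ ⟨g, hg, k, hk, hgk, rfl⟩
    have hm := hψ.map_mul g hg k hk hgk
    exact ⟨ψ g, Finset.mem_image_of_mem ψ hg, ψ k, Finset.mem_image_of_mem ψ hk,
      hm ▸ Finset.mem_image_of_mem ψ hgk, by simp [hm]⟩

theorem hammingLength_eq_one_sub {m : ℕ} (hm : 0 < m) (σ : Equiv.Perm (Fin m)) :
    hammingLength σ = 1 - (Nat.card {x : Fin m // σ x = x} : ℝ) / m := by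
  have hc : Nat.card {x : Fin m // σ x = x} + Nat.card {x : Fin m // σ x ≠ x} = m := by
    classical
    rw [← Nat.card_sum, Nat.card_congr (Equiv.sumCompl fun x => σ x = x), Nat.card_fin]
  have hc' : (Nat.card {x : Fin m // σ x = x} : ℝ) + Nat.card {x : Fin m // σ x ≠ x} = m := by
    exact_mod_cast hc
  have hm' : (m : ℝ) ≠ 0 := by positivity
  rw [hammingLength]
  field_simp
  linarith

theorem hammingLength_nonneg {m : ℕ} (σ : Equiv.Perm (Fin m)) : 0 ≤ hammingLength σ := by
  unfold hammingLength
  positivity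

theorem hammingLength_le_one {m : ℕ} (hm : 0 < m) (σ : Equiv.Perm (Fin m)) :
    hammingLength σ ≤ 1 := by
  rw [hammingLength_eq_one_sub hm]
  have : 0 ≤ (Nat.card {x : Fin m // σ x = x} : ℝ) / m := by positivity
  linarith

/-- The diagonal action of a permutation on `k`-tuples. -/
def tensorPower (m k : ℕ) : Equiv.Perm (Fin m) →* Equiv.Perm (Fin (m ^ k)) where
  toFun σ := finFunctionFinEquiv.permCongr (Equiv.piCongrRight fun _ : Fin k => σ)
  map_one' := Equiv.permCongr_refl _
  map_mul' σ τ := by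
    ext x
    simp only [Equiv.permCongr_apply, Equiv.Perm.mul_apply, Equiv.symm_apply_apply]
    rfl

/-- A tuple is fixed exactly when each coordinate is. -/
theorem card_fixed_tensorPower (m k : ℕ) (σ : Equiv.Perm (Fin m)) :
    Nat.card {x // tensorPower m k σ x = x} = Nat.card {x // σ x = x} ^ k := by
  have e : {x // tensorPower m k σ x = x} ≃ {f : Fin k → Fin m // ∀ i, σ (f i) = f i} := by
    refine finFunctionFinEquiv.symm.subtypeEquiv fun x => ?_
    change finFunctionFinEquiv
      (Equiv.piCongrRight (fun _ : Fin k => σ) (finFunctionFinEquiv.symm x)) = x ↔ _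
    rw [← Equiv.eq_symm_apply, funext_iff]
    rfl
  rw [Nat.card_congr (e.trans (Equiv.subtypePiEquivPi (p := fun _ x => σ x = x))), Nat.card_pi]
  simp

theorem hammingLength_tensorPower {m : ℕ} (hm : 0 < m) (k : ℕ) (σ : Equiv.Perm (Fin m)) :
    hammingLength (tensorPower m k σ) = 1 - (1 - hammingLength σ) ^ k := by
  rw [hammingLength_eq_one_sub (pow_pos hm k), hammingLength_eq_one_sub hm,
    card_fixed_tensorPower]
  push_cast
  rw [sub_sub_cancel, div_pow]

/-- Bernoulli's inequality: amplification enlarges errors at most linearly in `k`. -/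
theorem hammingLength_tensorPower_le {m : ℕ} (hm : 0 < m) (k : ℕ) (σ : Equiv.Perm (Fin m)) :
    hammingLength (tensorPower m k σ) ≤ k * hammingLength σ := by
  have h := one_add_mul_le_pow (a := -hammingLength σ)
    (by linarith [hammingLength_le_one hm σ]) k
  rw [hammingLength_tensorPower hm, sub_eq_add_neg 1 (hammingLength σ)]
  linarith

/-- In the definition of soficity the lower bound on the Hamming lengths can be taken to be
`1 / 2` on all nontrivial elements. -/
theorem IsSofic.exists_half_le {A : Type u} [Group A] (hA : IsSofic A) (Φ : Finset A) {ε : ℝ}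
    (hε : 0 < ε) :
    ∃ m : ℕ, 0 < m ∧ ∃ φ : A → Equiv.Perm (Fin m), φ 1 = 1 ∧
      (∀ g ∈ Φ, g ≠ 1 → 1 / 2 ≤ hammingLength (φ g)) ∧
      ∀ g ∈ Φ, ∀ h ∈ Φ, g * h ∈ Φ → hammingLength (φ (g * h) * (φ g * φ h)⁻¹) < ε := by
  obtain ⟨α, -, hα, H⟩ := hA
  -- Capping at `1` keeps the base in `[0, 1)`; finiteness of `Φ` gives one `k` for all its
  -- elements.
  have hk : ∀ᶠ k : ℕ in atTop, ∀ g ∈ Φ, g ≠ 1 → (1 - min (α g) 1) ^ k < 1 / 2 := by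
    refine (Finset.eventually_all Φ).mpr fun g _ => ?_
    by_cases hg : g = 1
    · simp [hg]
    have h0 : 0 < min (α g) 1 := lt_min (hα g hg) one_pos
    have ht := tendsto_pow_atTop_nhds_zero_of_lt_one
      (sub_nonneg.mpr (min_le_right (α g) 1)) (by linarith)
    filter_upwards [ht.eventually_lt_const (by norm_num : (0 : ℝ) < 1 / 2)] with k hk _ using hk
  obtain ⟨k, hk⟩ := hk.exists
  -- The power costs a factor at most `k`; `k + 1` also covers `k = 0`.
  obtain ⟨m, hm, φ, hφ1, hφ, hmul⟩ := H Φ (ε / (k + 1)) (by positivity)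
  refine ⟨m ^ k, pow_pos hm k, fun g => tensorPower m k (φ g), by simp [hφ1], ?_, ?_⟩
  · intro g hg hg1
    rw [hammingLength_tensorPower hm]
    have h1 : (1 - hammingLength (φ g)) ^ k ≤ (1 - min (α g) 1) ^ k :=
      pow_le_pow_left₀ (sub_nonneg.mpr (hammingLength_le_one hm _))
        (sub_le_sub_left ((min_le_left _ _).trans (hφ g hg)) 1) k
    linarith [hk g hg hg1]
  · intro g hg h hh hgh
    have h1 := hmul g hg h hh hgh
    rw [lt_div_iff₀ (by positivity)] at h1
    rw [← map_mul, ← map_inv, ← map_mul]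
    refine (hammingLength_tensorPower_le hm k _).trans_lt ?_
    linarith [hammingLength_nonneg (φ (g * h) * (φ g * φ h)⁻¹)]

/-- The target `B` and its `α` vary with `Φ`, so no `α` can be pulled back directly; the uniform
bound `1 / 2` replaces it. -/
theorem isSofic_of_localEmbeddings {A : Type u} [Group A]
    (h : ∀ Φ : Finset A, ∃ (B : Type v) (_ : Group B), IsSofic B ∧
      ∃ ψ : A → B, IsLocalEmbedding Φ ψ) : IsSofic A := by
  classical
  refine ⟨fun g => if g = 1 then 0 else 1 / 2, by simp, fun g hg => by simp [hg], ?_⟩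
  intro Φ ε hε
  obtain ⟨B, _, hB, ψ, hψ⟩ := h Φ
  obtain ⟨m, hm, φ, hφ1, hφ, hmul⟩ := hB.exists_half_le (Φ.image ψ) hε
  refine ⟨m, hm, φ ∘ ψ, by simp [hψ.map_one, hφ1], fun g hg => ?_, fun g hg k hk hgk => ?_⟩
  · by_cases hg1 : g = 1
    · simpa [hg1] using hammingLength_nonneg _
    · simpa [hg1] using hφ (ψ g) (Finset.mem_image_of_mem ψ hg) (hψ.map_ne_one g hg hg1)
  · have hm := hψ.map_mul g hg k hk hgk
    simpa [hm] using hmul (ψ g) (Finset.mem_image_of_mem ψ hg) (ψ k)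
      (Finset.mem_image_of_mem ψ hk) (hm ▸ Finset.mem_image_of_mem ψ hgk)

/-- Every finite subset of a group embeds locally into a group of any given universe. -/
theorem exists_localEmbedding (A : Type u) [Group A] (Φ : Finset A) :
    ∃ (B : Type v) (_ : Group B), ∃ ψ : A → B, IsLocalEmbedding Φ ψ := by
  classical
  let q : FreeGroup Φ →* A := FreeGroup.lift Subtype.val
  let S := q.range
  have : Countable (FreeGroup Φ) := inferInstanceAs (Countable (Quot _))
  have : Countable S := q.rangeRestrict_surjective.countable
  let e : S ≃* Shrink.{v} S := Shrink.mulEquiv.symm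
  have hS : ∀ g ∈ Φ, g ∈ S := fun g hg => ⟨FreeGroup.of ⟨g, hg⟩, by simp [q]⟩
  refine ⟨Shrink.{v} S, inferInstance, fun g => if hg : g ∈ S then e ⟨g, hg⟩ else 1, ?_, ?_, ?_⟩
  · rw [dif_pos S.one_mem]
    exact e.map_one
  · intro g hg hg1
    rw [dif_pos (hS g hg)]
    simpa using hg1
  · intro g hg h hh hgh
    rw [dif_pos (hS _ hg), dif_pos (hS _ hh), dif_pos (hS _ hgh), ← map_mul]
    rfl

/-- An existentially closed group contains a copy of the partial multiplication table of any
finite subset of any group. -/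
theorem IsExistentiallyClosed.exists_localEmbedding {G : Type u} [Group G]
    (hG : IsExistentiallyClosed G) (A : Type v) [Group A] (Φ : Finset A) :
    ∃ ψ : A → G, IsLocalEmbedding Φ ψ := by
  classical
  -- With `1` included, the relation `1 * 1 = 1` forces its variable to be trivial.
  let Ψ := insert 1 Φ
  obtain ⟨B, _, θ, hθ⟩ := GroupApprox.exists_localEmbedding.{v, u} A Ψ
  let e := Ψ.equivFin
  let t : Ψ → Word G Ψ.card := fun g => Monoid.Coprod.inr (FreeGroup.of (e g))
  have ht : ∀ {H : Type u} [Group H] (f : G →* H) (x : Fin Ψ.card → H) (g : Ψ),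
      Monoid.Coprod.lift f (FreeGroup.lift x) (t g) = x (e g) := by
    intro H _ f x g
    simp [t]
  let E : Finset (Word G Ψ.card) :=
    (Finset.univ.filter fun p : Ψ × Ψ × Ψ => (p.1 * p.2.1 : A) = p.2.2).image
      fun p => t p.1 * t p.2.1 * (t p.2.2)⁻¹
  let N : Finset (Word G Ψ.card) := (Finset.univ.filter fun g : Ψ => (g : A) ≠ 1).image t
  -- The overgroup is `G × B`, with the table solved in the second factor.
  obtain ⟨x, hxE, hxN⟩ := hG Ψ.card E N ⟨G × B, inferInstance, MonoidHom.inl G B,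
    fun a b hab => congrArg Prod.fst hab, fun i => (1, θ (e.symm i)), by
      constructor
      · intro w hw
        obtain ⟨⟨g, h, l⟩, hp, rfl⟩ := Finset.mem_image.mp hw
        have hp : (g * h : A) = l := (Finset.mem_filter.mp hp).2
        have := hθ.map_mul g g.2 h h.2 (hp ▸ l.2)
        simp only [Word.value, map_mul, map_inv, ht, Equiv.symm_apply_apply, mul_inv_eq_one,
          Prod.mk_mul_mk, one_mul, ← this, hp]
      · intro w hw
        obtain ⟨g, hg, rfl⟩ := Finset.mem_image.mp hw
        have := hθ.map_ne_one g g.2 (Finset.mem_filter.mp hg).2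
        simpa [Word.value, ht] using this⟩
  have hmul : ∀ g h l : Ψ, (g * h : A) = l → x (e g) * x (e h) = x (e l) := by
    intro g h l hp
    have := hxE _ (Finset.mem_image_of_mem _ (Finset.mem_filter.mpr
      ⟨Finset.mem_univ (g, h, l), hp⟩))
    simpa only [Word.value, map_mul, map_inv, ht, mul_inv_eq_one] using this
  have hne : ∀ g : Ψ, (g : A) ≠ 1 → x (e g) ≠ 1 := by
    intro g hg
    have := hxN _ (Finset.mem_image_of_mem _ (Finset.mem_filter.mpr ⟨Finset.mem_univ g, hg⟩))
    simpa only [Word.value, ht] using this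
  have hΨ : ∀ g ∈ Φ, g ∈ Ψ := fun g hg => Finset.mem_insert_of_mem hg
  have h1 : (1 : A) ∈ Ψ := Finset.mem_insert_self _ _
  refine ⟨fun g => if hg : g ∈ Ψ then x (e ⟨g, hg⟩) else 1, ?_, ?_, ?_⟩
  · rw [dif_pos h1]
    exact mul_eq_left.mp (hmul ⟨1, h1⟩ ⟨1, h1⟩ ⟨1, h1⟩ (one_mul 1))
  · intro g hg hg1
    rw [dif_pos (hΨ g hg)]
    exact hne _ hg1
  · intro g hg h hh hgh
    rw [dif_pos (hΨ _ hg), dif_pos (hΨ _ hh), dif_pos (hΨ _ hgh)]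
    exact (hmul _ _ _ rfl).symm

end GroupApprox

theorem mainTheorem5 (G : Type u) [Group G]
    (hG : GroupApprox.IsExistentiallyClosed G) :
    (∀ K ∈ ({GroupApprox.NilClass, GroupApprox.SolClass, GroupApprox.AltClass,
          GroupApprox.SymClass, GroupApprox.FinClass} : Set GroupApprox.GroupClass),
      (GroupApprox.IsApproximable K G ↔
        ∀ (A : Type v) [Group A], GroupApprox.IsApproximable K A)) ∧
    (GroupApprox.IsSofic G ↔ ∀ (A : Type v) [Group A], GroupApprox.IsSofic A) := by
  refine ⟨fun K _ => ⟨fun h A _ => ?_, fun h => ?_⟩, fun h A _ => ?_, fun h => ?_⟩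
  · exact GroupApprox.isApproximable_of_localEmbeddings fun Φ =>
      ⟨G, _, h, hG.exists_localEmbedding A Φ⟩
  · refine GroupApprox.isApproximable_of_localEmbeddings.{u, v} fun Φ => ?_
    obtain ⟨B, _, hB⟩ := GroupApprox.exists_localEmbedding.{u, v} G Φ
    exact ⟨B, _, h B, hB⟩
  · exact GroupApprox.isSofic_of_localEmbeddings fun Φ =>
      ⟨G, _, h, hG.exists_localEmbedding A Φ⟩
  · refine GroupApprox.isSofic_of_localEmbeddings.{u, v} fun Φ => ?_
    obtain ⟨B, _, hB⟩ := GroupApprox.exists_localEmbedding.{u, v} G Φ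
    exact ⟨B, _, h B, hB⟩
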